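/- A left ordering of a group $G$ is a strict total order $<$ on $G$ with $g<g' \Rightarrow hg<hg'$ for all $g,g',h\in G$; its positive cone is $\{g\in G : 1<g\}$. The set $\mathrm{LO}(G)$ of left orderings carries the topology induced by the product topology on $\{+,-\}^{G\setminus\{1\}}$ (with $\{+,-\}$ discrete), an ordering being sent to the signs of the elements $g\neq 1$; a left ordering is isolated if it is an isolated point of $\mathrm{LO}(G)$. Let $\mathcal S=\{s_1,\dots,s_k\}$ be an ordered finite generating set of $G$. A word on $\mathcal S\cup\mathcal S^{-1}$ is $i$-positive if it contains at least one $s_i$ but none of $s_1^{\pm1},\dots,s_{i-1}^{\pm1},s_i^{-1}$; an element of $G$ is $\sigma(\mathcal S)$-positive if for some $1\le i\le k$ it is represented by an $i$-positive word. We say that $\mathcal S$ defines a Dehornoy-like ordering if the set of $\sigma(\mathcal S)$-positive elements is the positive cone of a left ordering of $G$. We say that a finite generating set $\mathcal A$ of $G$ defines an isolated left ordering if the set of elements represented by non-empty words on $\mathcal A$ (without inverses) is the positive cone of an isolated left ordering of $G$. Theorem 3.1. Let $m,n\ge 2$ be integers with $(m,n)\neq(2,2)$, and let $G_{m,n}=\langle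 x,y \mid x^m=y^n\rangle$. Then $\mathcal S=\{s_1=xyx^{-m+1},\ s_2=x^{m-1}y^{-1}\}$ and $\mathcal A=\{a=x,\ b=yx^{-m+1}\}$ are generating sets of $G_{m,n}$, and 1. $\mathcal S$ (ordered as $s_1,s_2$) defines a Dehornoy-like ordering $<_D$ of $G_{m,n}$; 2. $\mathcal A$ defines an isolated left ordering $<_A$ of $G_{m,n}$. -/

import Mathlib

/-- A left ordering of a group: a strict total order preserved by left multiplication. -/
@[ext]
structure LeftOrdering (G : Type*) [Group G] where
  /-- the strict order relation -/
  lt : G → G → Prop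
  irrefl : ∀ g, ¬ lt g g
  trans : ∀ g h k, lt g h → lt h k → lt g k
  total : ∀ g h, lt g h ∨ g = h ∨ lt h g
  mul_left : ∀ k g h, lt g h → lt (k * g) (k * h)

namespace LeftOrdering

variable {G : Type*} [Group G]

/-- The positive cone `{g | 1 < g}`. -/
def positiveCone (o : LeftOrdering G) : Set G := {g | o.lt 1 g}

open Classical in
/-- The point of `{+,-}^(G - {1})` that corresponds to a left ordering. -/
noncomputable def sign (o : LeftOrdering G) : {g : G // g ≠ 1} → Bool :=
  fun g => decide (g.1 ∈ o.positiveCone)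

/-- The topology of the space `LO(G)` of left orderings: it is induced by the product topology
on `{+,-}^(G - {1})`, where `{+,-}` is discrete. -/
noncomputable instance : TopologicalSpace (LeftOrdering G) :=
  TopologicalSpace.induced sign inferInstance

/-- An isolated ordering is an isolated point of `LO(G)`. -/
def IsIsolated (o : LeftOrdering G) : Prop := IsOpen ({o} : Set (LeftOrdering G))

end LeftOrdering

section Words

variable {G : Type*} [Group G] {k : ℕ}

/-- The family `S = (s_1, ..., s_k)` (indexed from `0`) generates `G`. -/
def IsGenerating (S : Fin k → G) : Prop := Subgroup.closure (Set.range S) = ⊤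

/-- The element represented by a word on `S ∪ S⁻¹`; the letter `(i, true)` stands for `s_i` and
the letter `(i, false)` for `s_i⁻¹`. -/
def wordEval (S : Fin k → G) (w : List (Fin k × Bool)) : G :=
  (w.map fun p => cond p.2 (S p.1) (S p.1)⁻¹).prod

/-- A word is `i`-positive if it contains the letter `s_i`, but neither `s_i⁻¹` nor any
`s_j` or `s_j⁻¹` with `j < i`. -/
def IsPositiveWord (i : Fin k) (w : List (Fin k × Bool)) : Prop :=
  (i, true) ∈ w ∧ (i, false) ∉ w ∧ ∀ p ∈ w, i ≤ p.1

/-- The set of `σ(S)`-positive elements: those represented by an `i`-positive word for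
some `i`. -/
def sigmaPositive (S : Fin k → G) : Set G :=
  {g | ∃ i w, IsPositiveWord i w ∧ wordEval S w = g}

/-- The elements represented by non-empty words on `S` without inverse letters. -/
def wordPositive (S : Fin k → G) : Set G :=
  (Subsemigroup.closure (Set.range S) : Set G)

/-- `S` is a finite ordered generating set whose `σ(S)`-positive elements are the positive cone
of a left ordering. -/
def DefinesDehornoyLikeOrdering (S : Fin k → G) : Prop :=
  IsGenerating S ∧ ∃ o : LeftOrdering G, o.positiveCone = sigmaPositive S

/-- `S` is a finite generating set whose word positive elements are the positive cone of an
isolated left ordering. -/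
def DefinesIsolatedOrdering (S : Fin k → G) : Prop :=
  IsGenerating S ∧ ∃ o : LeftOrdering G, o.positiveCone = wordPositive S ∧ o.IsIsolated

end Words

/-- The group `⟨x, y | x ^ m = y ^ n⟩`. -/
abbrev TorusGroup (m n : ℕ) : Type :=
  PresentedGroup
    ({FreeGroup.of 0 ^ m * (FreeGroup.of 1 ^ n)⁻¹} : Set (FreeGroup (Fin 2)))

namespace TorusGroup

/-- The generator `x`. -/
def x (m n : ℕ) : TorusGroup m n := PresentedGroup.of 0

/-- The generator `y`. -/
def y (m n : ℕ) : TorusGroup m n := PresentedGroup.of 1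

/-- The ordered generating set `(x y x^(-m+1), x^(m-1) y⁻¹)`. -/
def genS (m n : ℕ) : Fin 2 → TorusGroup m n :=
  ![x m n * y m n * x m n ^ (-(m : ℤ) + 1), x m n ^ ((m : ℤ) - 1) * (y m n)⁻¹]

/-- The ordered generating set `(x, y x^(-m+1))`. -/
def genA (m n : ℕ) : Fin 2 → TorusGroup m n :=
  ![x m n, y m n * x m n ^ (-(m : ℤ) + 1)]

end TorusGroup

/-! Put `z = x ^ m = y ^ n`, which is central, `a = x` and `b = y * x * z⁻¹ = y * x ^ (1 - m)`. Then
the two generating sets are `(a * b, b⁻¹)` and `(a, b)`. Let P be the semigroup generated by `a` and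
`b`.

P is a positive cone. Every element has a form `z ^ e * x ^ i * h` with `0 ≤ i < m` and `h` a
product of blocks (`CentralPowers.exists_normalForm`). If `e ≥ 0` the element lies in P ∪ {1}; if `e
< 0` its inverse does, because inverting turns blocks into blocks. Conversely, left multiplication
by `a` or `b` keeps `e ≥ 0` and makes the form nontrivial. A nontrivial form with `e ≥ 0` is never
1: the free product of ℤ/m and ℤ/n detects `x ^ i * h`, and a map to ℤ detects `z ^ e`
(`CentralPowers.one_notMem_closure`). A finitely generated cone is isolated, which gives the second
claim.

For the first claim, `b ^ j * a * b ^ k` lies in P for all integers `j`, `k`; this is where (2, 2)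
is excluded. Hence a word on `a * b` and `b`, `b⁻¹` that contains `a * b` but not its inverse lies
in P. The σ-positive set is therefore P with its sign reversed on the powers of `b`, and it is again
a cone. -/

/-! ### Positive cones and isolated orderings -/

namespace LeftOrdering

variable {G : Type*} [Group G]

/-- The left ordering with a prescribed positive cone. -/
def ofCone (P : Set G) (hmul : ∀ g ∈ P, ∀ h ∈ P, g * h ∈ P) (hone : (1 : G) ∉ P)
    (htotal : ∀ g, g ≠ 1 → g ∈ P ∨ g⁻¹ ∈ P) : LeftOrdering G where
  lt g h := g⁻¹ * h ∈ P
  irrefl g := by simpa using hone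
  trans g h k h₁ h₂ := by simpa [mul_assoc] using hmul _ h₁ _ h₂
  total g h := by
    by_cases hgh : g = h
    · exact Or.inr (Or.inl hgh)
    · rcases htotal (g⁻¹ * h) (by rwa [Ne, inv_mul_eq_one]) with h₁ | h₁
      · exact Or.inl h₁
      · exact Or.inr (Or.inr (by simpa using h₁))
  mul_left k g h h₁ := by simpa [mul_assoc] using h₁

theorem positiveCone_ofCone (P : Set G) (hmul : ∀ g ∈ P, ∀ h ∈ P, g * h ∈ P)
    (hone : (1 : G) ∉ P) (htotal : ∀ g, g ≠ 1 → g ∈ P ∨ g⁻¹ ∈ P) :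
    (ofCone P hmul hone htotal).positiveCone = P := by
  ext g
  simp [positiveCone, ofCone]

theorem mul_mem_positiveCone (o : LeftOrdering G) {g h : G} (hg : g ∈ o.positiveCone)
    (hh : h ∈ o.positiveCone) : g * h ∈ o.positiveCone := by
  have := o.mul_left g 1 h hh
  rw [mul_one] at this
  exact o.trans _ _ _ hg this

theorem not_lt_of_lt (o : LeftOrdering G) {g h : G} (h₁ : o.lt g h) : ¬ o.lt h g :=
  fun h₂ => o.irrefl _ (o.trans _ _ _ h₁ h₂)

theorem lt_iff_mem_positiveCone (o : LeftOrdering G) (g h : G) :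
    o.lt g h ↔ g⁻¹ * h ∈ o.positiveCone := by
  constructor
  · intro h₁
    simpa [positiveCone] using o.mul_left g⁻¹ g h h₁
  · intro h₁
    simpa using o.mul_left g 1 _ h₁

/-- Positive cones are maximal: by totality of the smaller order, an extra positive element would
have both signs in the larger one. -/
theorem eq_of_positiveCone_subset (o o' : LeftOrdering G)
    (h : o.positiveCone ⊆ o'.positiveCone) : o' = o := by
  have key : ∀ g k, o.lt g k → o'.lt g k := fun g k hgk =>
    (o'.lt_iff_mem_positiveCone g k).2 (h ((o.lt_iff_mem_positiveCone g k).1 hgk))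
  ext g k
  refine ⟨fun h' => ?_, key g k⟩
  rcases o.total g k with h₁ | rfl | h₁
  · exact h₁
  · exact (o'.irrefl _ h').elim
  · exact (o'.not_lt_of_lt h' (key _ _ h₁)).elim

theorem isOpen_setOf_mem_positiveCone (g : G) :
    IsOpen {o : LeftOrdering G | g ∈ o.positiveCone} := by
  classical
  by_cases hg : g = 1
  · have : {o : LeftOrdering G | g ∈ o.positiveCone} = ∅ := by
      ext o
      simpa [hg, positiveCone] using o.irrefl 1
    rw [this]
    exact isOpen_empty
  · have hc : Continuous (fun o : LeftOrdering G => o.sign ⟨g, hg⟩) :=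
      (continuous_apply (⟨g, hg⟩ : {g : G // g ≠ 1})).comp
        (continuous_induced_dom (f := sign))
    have := (isOpen_discrete ({true} : Set Bool)).preimage hc
    convert this using 1
    ext o
    simp [sign]

/-- A left ordering whose positive cone is finitely generated as a semigroup is isolated. -/
theorem isIsolated_of_positiveCone_eq {k : ℕ} (o : LeftOrdering G) (S : Fin k → G)
    (h : o.positiveCone = wordPositive S) : o.IsIsolated := by
  -- Finitely many sign conditions, one per generator, force the whole cone.
  have : ({o} : Set (LeftOrdering G)) = ⋂ i, {o' | S i ∈ o'.positiveCone} := by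
    ext o'
    simp only [Set.mem_singleton_iff, Set.mem_iInter, Set.mem_ofPred_eq]
    constructor
    · rintro rfl i
      rw [h]
      exact Subsemigroup.subset_closure ⟨i, rfl⟩
    · intro h'
      refine eq_of_positiveCone_subset o o' ?_
      rw [h]
      intro g hg
      refine Subsemigroup.closure_induction (p := fun g _ => g ∈ o'.positiveCone)
        ?_ (fun _ _ _ _ => o'.mul_mem_positiveCone) hg
      rintro _ ⟨i, rfl⟩
      exact h' i
  rw [IsIsolated, this]
  exact isOpen_iInter_of_finite fun i => isOpen_setOf_mem_positiveCone _

end LeftOrdering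

/-! ### σ-positive words -/

section Words

variable {G : Type*} [Group G] {k : ℕ}

theorem IsPositiveWord.append {i j : Fin k} {v w : List (Fin k × Bool)}
    (hv : IsPositiveWord i v) (hw : IsPositiveWord j w) :
    IsPositiveWord (min i j) (v ++ w) := by
  obtain ⟨hv₁, hv₂, hv₃⟩ := hv
  obtain ⟨hw₁, hw₂, hw₃⟩ := hw
  refine ⟨?_, ?_, ?_⟩
  · rcases le_total i j with hij | hij
    · simp [min_eq_left hij, hv₁]
    · simp [min_eq_right hij, hw₁]
  · rw [List.mem_append, not_or]
    rcases lt_trichotomy i j with hij | rfl | hij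
    · rw [min_eq_left hij.le]
      exact ⟨hv₂, fun h => absurd (hw₃ _ h) (not_le.2 hij)⟩
    · simp [hv₂, hw₂]
    · rw [min_eq_right hij.le]
      exact ⟨fun h => absurd (hv₃ _ h) (not_le.2 hij), hw₂⟩
  · intro p hp
    rcases List.mem_append.1 hp with hp | hp
    · exact (min_le_left _ _).trans (hv₃ p hp)
    · exact (min_le_right _ _).trans (hw₃ p hp)

theorem wordEval_append (S : Fin k → G) (v w : List (Fin k × Bool)) :
    wordEval S (v ++ w) = wordEval S v * wordEval S w := by
  simp [wordEval]

theorem sigmaPositive_mul_mem (S : Fin k → G) {g h : G} (hg : g ∈ sigmaPositive S)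
    (hh : h ∈ sigmaPositive S) : g * h ∈ sigmaPositive S := by
  obtain ⟨i, v, hv, rfl⟩ := hg
  obtain ⟨j, w, hw, rfl⟩ := hh
  exact ⟨_, _, hv.append hw, wordEval_append S v w⟩

end Words

/-! ### Normal forms and totality of the cone -/

/-- The data of the amalgamated product `⟨x⟩ *_{⟨z⟩} ⟨y⟩`, with `z = x ^ m = y ^ n` central. -/
structure CentralPowers {G : Type*} [Group G] (m n : ℕ) (x y z : G) : Prop where
  two_le_left : 2 ≤ m
  two_le_right : 2 ≤ n
  comm : ∀ g, z * g = g * z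
  pow_left : x ^ m = z
  pow_right : y ^ n = z

/-- The products of blocks `y ^ j x ^ i z⁻¹` with `0 < j < n` and `0 < i < m`, followed by a
power `y ^ j` with `0 ≤ j < n`. -/
inductive IsBlockProduct {G : Type*} [Group G] (m n : ℕ) (x y z : G) : G → Prop
  | pow (j : ℕ) (hj : j < n) : IsBlockProduct m n x y z (y ^ j)
  | block (j i : ℕ) (hj₀ : 0 < j) (hj : j < n) (hi₀ : 0 < i) (hi : i < m) (h : G)
      (hh : IsBlockProduct m n x y z h) : IsBlockProduct m n x y z (y ^ j * x ^ i * z⁻¹ * h)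

namespace CentralPowers

variable {G : Type*} [Group G] {m n : ℕ} {x y z : G}

theorem inv_comm (H : CentralPowers m n x y z) (g : G) : z⁻¹ * g = g * z⁻¹ := by
  rw [inv_mul_eq_iff_eq_mul, ← mul_assoc, H.comm, mul_inv_cancel_right]

theorem pow_comm (H : CentralPowers m n x y z) (e : ℕ) (g : G) : z ^ e * g = g * z ^ e :=
  (show Commute z g from H.comm g).pow_left e

theorem zpow_comm (H : CentralPowers m n x y z) (e : ℤ) (g : G) : z ^ e * g = g * z ^ e :=
  (show Commute z g from H.comm g).zpow_left e

/-- Left multiplication by `y`, up to carrying over a power of `x` or `z`. -/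
theorem mul_blockProduct (H : CentralPowers m n x y z) {h : G}
    (hh : IsBlockProduct m n x y z h) :
    (IsBlockProduct m n x y z (y * h) ∧
      ((∃ j, 0 < j ∧ j < n ∧ y * h = y ^ j) ∨
        ∃ j i h', 0 < j ∧ j < n ∧ 0 < i ∧ i < m ∧ IsBlockProduct m n x y z h' ∧
          y * h = y ^ j * x ^ i * z⁻¹ * h')) ∨
      y * h = z ∨
      ∃ i h', 0 < i ∧ i < m ∧ IsBlockProduct m n x y z h' ∧ y * h = x ^ i * h' := by
  cases hh with
  | pow j hj =>
    rw [← pow_succ']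
    rcases (Nat.succ_le_of_lt hj).lt_or_eq with hj' | hj'
    · exact Or.inl ⟨.pow _ hj', Or.inl ⟨_, Nat.succ_pos j, hj', rfl⟩⟩
    · right; left
      rw [← H.pow_right, ← hj']
  | block j i hj₀ hj hi₀ hi h hh =>
    have e : y * (y ^ j * x ^ i * z⁻¹ * h) = y ^ (j + 1) * x ^ i * z⁻¹ * h := by
      simp only [pow_succ', mul_assoc]
    rw [e]
    rcases (Nat.succ_le_of_lt hj).lt_or_eq with hj' | hj'
    · exact Or.inl ⟨.block _ _ (Nat.succ_pos j) hj' hi₀ hi h hh,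
        Or.inr ⟨_, i, h, Nat.succ_pos j, hj', hi₀, hi, hh, rfl⟩⟩
    -- Here `j = n - 1`, so `y ^ n = z` cancels the `z⁻¹` of the first block and frees its power of
    -- `x`.
    · right; right
      refine ⟨i, h, hi₀, hi, hh, ?_⟩
      rw [show j + 1 = n from hj', H.pow_right, H.comm, mul_inv_cancel_right]

/-- With `b = y * x * z⁻¹` one has `y = b * x ^ (m - 1)`. -/
theorem mem_right (H : CentralPowers m n x y z) {M : Submonoid G} (hx : x ∈ M)
    (hb : y * x * z⁻¹ ∈ M) : y ∈ M := by
  have h : y = y * x * z⁻¹ * x ^ (m - 1) := by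
    rw [mul_assoc _ z⁻¹, H.inv_comm, ← mul_assoc, mul_assoc y, ← pow_succ',
      Nat.sub_add_cancel (by have := H.two_le_left; lia), H.pow_left, mul_inv_cancel_right]
  rw [h]
  exact mul_mem hb (pow_mem hx _)

theorem block_mem (H : CentralPowers m n x y z) {M : Submonoid G} (hx : x ∈ M)
    (hb : y * x * z⁻¹ ∈ M) {j i : ℕ} (hj : 0 < j) (hi : 0 < i) :
    y ^ j * x ^ i * z⁻¹ ∈ M := by
  obtain ⟨j, rfl⟩ := Nat.exists_eq_succ_of_ne_zero hj.ne'
  obtain ⟨i, rfl⟩ := Nat.exists_eq_succ_of_ne_zero hi.ne'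
  have h : y ^ (j + 1) * x ^ (i + 1) * z⁻¹ = y ^ j * (y * x * z⁻¹) * x ^ i := by
    simp only [pow_succ y, pow_succ' x, mul_assoc]
    rw [H.inv_comm]
  rw [Nat.succ_eq_add_one, Nat.succ_eq_add_one, h]
  exact mul_mem (mul_mem (pow_mem (H.mem_right hx hb) _) hb) (pow_mem hx _)

theorem blockProduct_mem (H : CentralPowers m n x y z) {M : Submonoid G} (hx : x ∈ M)
    (hb : y * x * z⁻¹ ∈ M) {h : G} (hh : IsBlockProduct m n x y z h) : h ∈ M := by
  induction hh with
  | pow j hj => exact pow_mem (H.mem_right hx hb) _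
  | block j i hj₀ hj hi₀ hi h hh ih => exact mul_mem (H.block_mem hx hb hj₀ hi₀) ih

/-- Since `y⁻ʲ = y ^ (n - j) * z⁻¹` and `x⁻ⁱ = x ^ (m - i) * z⁻¹`, the extra `z` leaves exactly one
`z⁻¹`, with both exponents positive. -/
theorem inv_pow_mul_inv_pow_mem (H : CentralPowers m n x y z) {M : Submonoid G} (hx : x ∈ M)
    (hb : y * x * z⁻¹ ∈ M) {j i : ℕ} (hj : j < n) (hi : i < m) :
    (y ^ j)⁻¹ * (x ^ i)⁻¹ * z ∈ M := by
  have h : (y ^ j)⁻¹ * (x ^ i)⁻¹ * z = y ^ (n - j) * x ^ (m - i) * z⁻¹ := by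
    rw [pow_sub y hj.le, pow_sub x hi.le, H.pow_left, H.pow_right]
    simp only [mul_assoc, H.comm]
    rw [H.comm]
    simp
  rw [h]
  exact H.block_mem hx hb (by lia) (by lia)

/-- Inversion regroups the letters: the power of `y` in a block pairs with the power of `x` just
before it. The quantified `i` is that preceding power, which makes the induction go through. -/
theorem inv_blockProduct_mem (H : CentralPowers m n x y z) {M : Submonoid G} (hx : x ∈ M)
    (hb : y * x * z⁻¹ ∈ M) {h : G} (hh : IsBlockProduct m n x y z h) :
    ∀ i < m, h⁻¹ * (x ^ i)⁻¹ * z ∈ M := by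
  induction hh with
  | pow j hj => exact fun i hi => H.inv_pow_mul_inv_pow_mem hx hb hj hi
  | block j i hj₀ hj hi₀ hi h hh ih =>
    intro i' hi'
    have e : (y ^ j * x ^ i * z⁻¹ * h)⁻¹ * (x ^ i')⁻¹ * z =
        (h⁻¹ * (x ^ i)⁻¹ * z) * ((y ^ j)⁻¹ * (x ^ i')⁻¹ * z) := by
      simp only [mul_inv_rev, inv_inv, mul_assoc]
      rw [← mul_assoc z, H.comm (x ^ i)⁻¹, mul_assoc]
    rw [e]
    exact mul_mem (ih i hi) (H.inv_pow_mul_inv_pow_mem hx hb hj hi')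

/-- Every element of the group generated by `x` and `y` has a normal form. -/
theorem exists_normalForm (H : CentralPowers m n x y z)
    (hgen : Subgroup.closure {x, y} = ⊤) (g : G) :
    ∃ (e : ℤ) (i : ℕ) (h : G), i < m ∧ IsBlockProduct m n x y z h ∧ g = z ^ e * x ^ i * h := by
  have hm := H.two_le_left
  have hn := H.two_le_right
  have h_one : IsBlockProduct m n x y z 1 := by
    simpa using IsBlockProduct.pow (m := m) (x := x) (y := y) (z := z) 0 (by lia : 0 < n)
  let D : Set G := {g | ∃ (e : ℤ) (i : ℕ) (h : G), i < m ∧ IsBlockProduct m n x y z h ∧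
    g = z ^ e * x ^ i * h}
  have hz : ∀ (e : ℤ), ∀ g ∈ D, z ^ e * g ∈ D := by
    rintro e _ ⟨e', i, h, hi, hh, rfl⟩
    exact ⟨e + e', i, h, hi, hh, by simp only [zpow_add, mul_assoc]⟩
  have hxD : ∀ g ∈ D, x * g ∈ D := by
    rintro _ ⟨e, i, h, hi, hh, rfl⟩
    have e₁ : x * (z ^ e * x ^ i * h) = z ^ e * (x ^ (i + 1) * h) := by
      rw [pow_succ', ← mul_assoc, ← mul_assoc, ← H.zpow_comm]
      simp only [mul_assoc]
    rw [e₁]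
    refine hz _ _ ?_
    rcases (Nat.succ_le_of_lt hi).lt_or_eq with hi' | hi'
    · exact ⟨0, i + 1, h, hi', hh, by simp⟩
    · exact ⟨1, 0, h, by lia, hh, by rw [show i + 1 = m from hi', H.pow_left]; simp⟩
  have hyD : ∀ g ∈ D, y * g ∈ D := by
    rintro _ ⟨e, i, h, hi, hh, rfl⟩
    have e₁ : y * (z ^ e * x ^ i * h) = z ^ e * (y * x ^ i * h) := by
      rw [← mul_assoc, ← mul_assoc, ← H.zpow_comm]
      simp only [mul_assoc]
    rw [e₁]
    refine hz _ _ ?_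
    rcases Nat.eq_zero_or_pos i with rfl | hi₀
    · rw [pow_zero, mul_one]
      rcases H.mul_blockProduct hh with ⟨h₁, -⟩ | h₁ | ⟨i, h', -, hi, hh', h₁⟩
      · exact ⟨0, 0, _, by lia, h₁, by simp⟩
      · exact ⟨1, 0, 1, by lia, h_one, by simp [h₁]⟩
      · exact ⟨0, i, h', hi, hh', by simp [h₁]⟩
    -- `y * x ^ i` becomes a block at the cost of one factor `z`.
    · refine ⟨1, 0, _, by lia, .block 1 i one_pos (by lia) hi₀ hi h hh, ?_⟩
      rw [← mul_assoc, pow_zero, zpow_one, mul_one, pow_one, ← mul_assoc, H.comm,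
        mul_inv_cancel_right]
  have hpowx : ∀ (k : ℕ), ∀ g ∈ D, x ^ k * g ∈ D := by
    intro k
    induction k with
    | zero => simp
    | succ k ih => intro g hg; rw [pow_succ, mul_assoc]; exact ih _ (hxD _ hg)
  have hpowy : ∀ (k : ℕ), ∀ g ∈ D, y ^ k * g ∈ D := by
    intro k
    induction k with
    | zero => simp
    | succ k ih => intro g hg; rw [pow_succ, mul_assoc]; exact ih _ (hyD _ hg)
  have hinv : ∀ (u : G) (k : ℕ), u ^ (k + 1) = z → u⁻¹ = z ^ (-1 : ℤ) * u ^ k := by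
    intro u k hu
    rw [← hu]
    simp [pow_succ]
  have hg : g ∈ Subgroup.closure {x, y} := hgen ▸ Subgroup.mem_top g
  induction hg using Subgroup.closure_induction_left with
  | one => exact ⟨0, 0, 1, by lia, h_one, by simp⟩
  | mul_left u hu g _ ih =>
    rcases hu with rfl | rfl
    · exact hxD _ ih
    · exact hyD _ ih
  | inv_mul_cancel u hu g _ ih =>
    rcases hu with rfl | rfl
    · rw [hinv u (m - 1) (by rw [Nat.sub_add_cancel (by lia), H.pow_left]), mul_assoc]
      exact hz _ _ (hpowx _ _ ih)
    · rw [hinv u (n - 1) (by rw [Nat.sub_add_cancel (by lia), H.pow_right]), mul_assoc]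
      exact hz _ _ (hpowy _ _ ih)

theorem mem_or_inv_mem (H : CentralPowers m n x y z) (hgen : Subgroup.closure {x, y} = ⊤)
    {M : Submonoid G} (hx : x ∈ M) (hb : y * x * z⁻¹ ∈ M) (g : G) : g ∈ M ∨ g⁻¹ ∈ M := by
  obtain ⟨e, i, h, hi, hh, rfl⟩ := H.exists_normalForm hgen g
  have hzM : z ∈ M := H.pow_left ▸ pow_mem hx m
  rcases le_or_gt 0 e with he | he
  · left
    lift e to ℕ using he
    rw [zpow_natCast]
    exact mul_mem (mul_mem (pow_mem hzM _) (pow_mem hx _)) (H.blockProduct_mem hx hb hh)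
  · right
    -- One `z` of the inverse is spent on regrouping the blocks; `z ^ k` remains.
    obtain ⟨k, rfl⟩ : ∃ k : ℕ, e = -(k + 1) := ⟨(-e - 1).toNat, by lia⟩
    have h₁ : (z ^ (-((k : ℤ) + 1)) * x ^ i * h)⁻¹ = h⁻¹ * (x ^ i)⁻¹ * z * z ^ k := by
      rw [mul_inv_rev, mul_inv_rev, ← zpow_neg, neg_neg, mul_assoc _ z, ← pow_succ',
        ← zpow_natCast z, mul_assoc, Nat.cast_succ]
    rw [h₁]
    exact mul_mem (H.inv_blockProduct_mem hx hb hh i hi) (pow_mem hzM _)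

end CentralPowers

/-! ### The identity is not positive -/

theorem Monoid.CoprodI.NeWord.prod_ne_one {ι : Type*} {K : ι → Type*} [∀ i, Monoid (K i)]
    {i j : ι} (w : NeWord K i j) : w.prod ≠ 1 := by
  classical
  intro h
  have h₁ : w.toWord = Word.empty := by
    refine Word.equiv.symm.injective ?_
    change w.toWord.prod = Word.empty.prod
    rw [Word.prod_empty]
    exact h
  exact w.toList_ne_nil (congrArg Word.toList h₁)

namespace CentralPowers

open Monoid.CoprodI

variable {G : Type*} [Group G] {m n : ℕ} {x y z : G}

theorem exists_neWord_of_blockProduct {K : Fin 2 → Type*} [∀ i, Group (K i)]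
    {u : K 0} {v : K 1} (hu : ∀ i, 0 < i → i < m → u ^ i ≠ 1) (hv : ∀ j, 0 < j → j < n → v ^ j ≠ 1)
    (φ : G →* Monoid.CoprodI K) (hφx : φ x = of u) (hφy : φ y = of v) (hφz : φ z = 1)
    {h : G} (hh : IsBlockProduct m n x y z h) :
    h = 1 ∨ ∃ (l : Fin 2) (w : NeWord K 1 l), w.prod = φ h := by
  induction hh with
  | pow j hj =>
    rcases Nat.eq_zero_or_pos j with rfl | hj₀
    · exact Or.inl (pow_zero y)
    · exact Or.inr ⟨1, .singleton (v ^ j) (hv j hj₀ hj), by simp [hφy]⟩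
  | block j i hj₀ hj hi₀ hi h hh ih =>
    right
    let w₀ : NeWord K 1 0 := .append (.singleton (v ^ j) (hv j hj₀ hj)) (by decide)
      (.singleton (u ^ i) (hu i hi₀ hi))
    have hw₀ : w₀.prod = φ (y ^ j * x ^ i * z⁻¹) := by simp [w₀, hφx, hφy, hφz]
    rcases ih with rfl | ⟨l, w, hw⟩
    · exact ⟨0, w₀, by rw [hw₀, mul_one]⟩
    · exact ⟨l, .append w₀ (by decide) w, by rw [NeWord.append_prod, hw₀, hw, ← map_mul]⟩

/-- Since `φ` kills `z`, it sends a nontrivial `x ^ i * h` to a nonempty reduced word of the free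
product. Only pure powers of `z` escape it, and these are covered by `hz`. -/
theorem one_notMem_closure (H : CentralPowers m n x y z) {K : Fin 2 → Type*}
    [∀ i, Group (K i)] {u : K 0} {v : K 1} (hu : ∀ i, 0 < i → i < m → u ^ i ≠ 1)
    (hv : ∀ j, 0 < j → j < n → v ^ j ≠ 1) (φ : G →* Monoid.CoprodI K)
    (hφx : φ x = of u) (hφy : φ y = of v) (hφz : φ z = 1) (hz : ∀ e, 0 < e → z ^ e ≠ 1) :
    (1 : G) ∉ Subsemigroup.closure ({x, y * x * z⁻¹} : Set G) := by
  have hm := H.two_le_left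
  have hn := H.two_le_right
  have h_one : IsBlockProduct m n x y z 1 := by
    simpa using IsBlockProduct.pow (m := m) (x := x) (y := y) (z := z) 0 (by lia : 0 < n)
  have hword : ∀ {h : G}, IsBlockProduct m n x y z h →
      h = 1 ∨ ∃ (l : Fin 2) (w : NeWord K 1 l), w.prod = φ h :=
    fun hh => exists_neWord_of_blockProduct hu hv φ hφx hφy hφz hh
  have hpow : ∀ j, 0 < j → j < n → y ^ j ≠ 1 := by
    intro j hj₀ hj h
    refine (NeWord.singleton (v ^ j) (hv j hj₀ hj)).prod_ne_one ?_
    rw [NeWord.prod_singleton, map_pow, ← hφy, ← map_pow, h, map_one]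
  have hblock : ∀ j i h, 0 < j → j < n → 0 < i → i < m → IsBlockProduct m n x y z h →
      y ^ j * x ^ i * z⁻¹ * h ≠ 1 := by
    intro j i h hj₀ hj hi₀ hi hh h₁
    let w₀ : NeWord K 1 0 := .append (.singleton (v ^ j) (hv j hj₀ hj)) (by decide)
      (.singleton (u ^ i) (hu i hi₀ hi))
    have hw₀ : w₀.prod = φ (y ^ j * x ^ i * z⁻¹) := by simp [w₀, hφx, hφy, hφz]
    rcases hword hh with rfl | ⟨l, w, hw⟩
    · refine w₀.prod_ne_one ?_
      rw [hw₀, ← map_one φ, ← h₁, mul_one]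
    · refine (NeWord.append w₀ (by decide) w).prod_ne_one ?_
      rw [NeWord.append_prod, hw₀, hw, ← map_mul, h₁, map_one]
  -- Products with a non-negative exponent of `z`, and the non-trivial ones among them.
  let D : Set G := {g | ∃ (e i : ℕ) (h : G), i < m ∧ IsBlockProduct m n x y z h ∧
    g = z ^ e * x ^ i * h}
  let D' : Set G := {g | ∃ (e i : ℕ) (h : G), i < m ∧ IsBlockProduct m n x y z h ∧
    (0 < e ∨ 0 < i ∨ h ≠ 1) ∧ g = z ^ e * x ^ i * h}
  have hD'D : D' ⊆ D := by
    rintro _ ⟨e, i, h, hi, hh, -, rfl⟩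
    exact ⟨e, i, h, hi, hh, rfl⟩
  have hzD' : ∀ (e : ℕ), ∀ g ∈ D', z ^ e * g ∈ D' := by
    rintro e _ ⟨e', i, h, hi, hh, h₀, rfl⟩
    exact ⟨e + e', i, h, hi, hh, by lia, by simp only [pow_add, mul_assoc]⟩
  have hxD : ∀ g ∈ D, x * g ∈ D' := by
    rintro _ ⟨e, i, h, hi, hh, rfl⟩
    have e₁ : x * (z ^ e * x ^ i * h) = z ^ e * (x ^ (i + 1) * h) := by
      rw [pow_succ', ← mul_assoc, ← mul_assoc, ← H.pow_comm]
      simp only [mul_assoc]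
    rw [e₁]
    refine hzD' _ _ ?_
    rcases (Nat.succ_le_of_lt hi).lt_or_eq with hi' | hi'
    · exact ⟨0, i + 1, h, hi', hh, by lia, by simp⟩
    · exact ⟨1, 0, h, by lia, hh, by lia, by rw [show i + 1 = m from hi', H.pow_left]; simp⟩
  have hbD : ∀ g ∈ D, y * x * z⁻¹ * g ∈ D' := by
    rintro _ ⟨e, i, h, hi, hh, rfl⟩
    have e₁ : y * x * z⁻¹ * (z ^ e * x ^ i * h) = z ^ e * (y * x ^ (i + 1) * z⁻¹ * h) := by
      rw [mul_assoc (z ^ e), ← mul_assoc _ (z ^ e), ← H.pow_comm, pow_succ']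
      simp only [mul_assoc]
      rw [← mul_assoc z⁻¹, H.inv_comm (x ^ i), mul_assoc]
    rw [e₁]
    refine hzD' _ _ ?_
    rcases (Nat.succ_le_of_lt hi).lt_or_eq with hi' | hi'
    · refine ⟨0, 0, _, by lia, .block 1 (i + 1) one_pos (by lia) i.succ_pos hi' h hh,
        Or.inr (Or.inr (hblock _ _ _ one_pos (by lia) i.succ_pos hi' hh)), by simp⟩
    -- The product collapses to `y * h`, whose carry cannot lower the exponent of `z`.
    · rw [show i + 1 = m from hi', H.pow_left, mul_inv_cancel_right]
      rcases H.mul_blockProduct hh with ⟨h₁, h₂⟩ | h₁ | ⟨i, h', hi₀, hi, hh', h₁⟩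
      · refine ⟨0, 0, _, by lia, h₁, Or.inr (Or.inr ?_), by simp⟩
        rcases h₂ with ⟨j, hj₀, hj, h₂⟩ | ⟨j, i, h', hj₀, hj, hi₀, hi, hh', h₂⟩
        · exact h₂ ▸ hpow j hj₀ hj
        · exact h₂ ▸ hblock j i h' hj₀ hj hi₀ hi hh'
      · exact ⟨1, 0, 1, by lia, h_one, by lia, by simp [h₁]⟩
      · exact ⟨0, i, h', hi, hh', by lia, by simp [h₁]⟩
  have hmul : ∀ p ∈ Subsemigroup.closure ({x, y * x * z⁻¹} : Set G), ∀ g ∈ D, p * g ∈ D' := by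
    intro p hp
    induction hp using Subsemigroup.closure_induction with
    | mem p hp =>
      rcases hp with rfl | rfl
      · exact hxD
      · exact hbD
    | mul p q _ _ ihp ihq =>
      intro g hg
      rw [mul_assoc]
      exact ihp _ (hD'D (ihq _ hg))
  intro h₁
  obtain ⟨e, i, h, hi, hh, h₀, h₂⟩ := hmul 1 h₁ 1 ⟨0, 0, 1, by lia, h_one, by simp⟩
  rw [mul_one] at h₂
  -- This forces `i = 0` and `h = 1`, so nontriviality of the form leaves `z ^ e = 1` with `e > 0`.
  have h₃ : φ (x ^ i * h) = 1 := by
    have := congrArg φ h₂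
    rw [mul_assoc, map_mul, map_pow, hφz, one_pow, one_mul, map_one] at this
    exact this.symm
  rcases Nat.eq_zero_or_pos i with rfl | hi₀
  · rw [pow_zero, one_mul] at h₃
    rcases hword hh with rfl | ⟨l, w, hw⟩
    · exact hz e (by simpa using h₀) (by simpa using h₂.symm)
    · exact w.prod_ne_one (hw.trans h₃)
  · let w₀ : NeWord K 0 0 := .singleton (u ^ i) (hu i hi₀ hi)
    have hw₀ : w₀.prod = φ (x ^ i) := by simp [w₀, hφx]
    rcases hword hh with rfl | ⟨l, w, hw⟩
    · exact w₀.prod_ne_one (by rw [hw₀, ← mul_one (x ^ i), h₃])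
    · refine (NeWord.append w₀ (by decide) w).prod_ne_one ?_
      rw [NeWord.append_prod, hw₀, hw, ← map_mul, h₃]

end CentralPowers

/-! ### Absorption of powers of b -/

section Absorption

variable {G : Type*} [Group G]

/-- If `a = q a b = b a q' = b a r a b` with `q`, `q'`, `r` in the monoid, then the semigroup ideal
of `a` absorbs all powers of `b`. -/
theorem zpow_mul_mul_zpow_mem {M : Submonoid G} {a b q q' r : G} (ha : a ∈ M) (hb : b ∈ M)
    (hq : q ∈ M) (hq' : q' ∈ M) (hr : r ∈ M) (h₁ : q * a * b = a) (h₂ : b * a * q' = a)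
    (h₃ : b * a * r * a * b = a) (j k : ℤ) : b ^ j * a * b ^ k ∈ M := by
  have hright : ∀ k : ℕ, a * (b ^ k)⁻¹ ∈ M := by
    intro k
    induction k with
    | zero => simpa using ha
    | succ k ih =>
      have : a * (b ^ (k + 1))⁻¹ = q * (a * (b ^ k)⁻¹) := by
        nth_rewrite 1 [← h₁]
        simp [pow_succ, mul_assoc]
      exact this ▸ mul_mem hq ih
  have hleft : ∀ k : ℕ, (b ^ k)⁻¹ * a ∈ M := by
    intro k
    induction k with
    | zero => simpa using ha
    | succ k ih =>
      have : (b ^ (k + 1))⁻¹ * a = (b ^ k)⁻¹ * a * q' := by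
        nth_rewrite 1 [← h₂]
        simp [pow_succ', mul_assoc]
      exact this ▸ mul_mem ih hq'
  have hboth : ∀ j k : ℕ, (b ^ j)⁻¹ * a * (b ^ k)⁻¹ ∈ M := by
    intro j k
    rcases j with - | j
    · simpa using hright k
    rcases k with - | k
    · simpa using hleft (j + 1)
    have : (b ^ (j + 1))⁻¹ * a * (b ^ (k + 1))⁻¹ = (b ^ j)⁻¹ * a * r * (a * (b ^ k)⁻¹) := by
      nth_rewrite 1 [← h₃]
      rw [pow_succ', pow_succ b k]
      simp [mul_assoc]
    exact this ▸ mul_mem (mul_mem (hleft j) hr) (hright k)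
  obtain ⟨j, rfl | rfl⟩ := j.eq_nat_or_neg <;> obtain ⟨k, rfl | rfl⟩ := k.eq_nat_or_neg <;>
    simp only [zpow_neg, zpow_natCast]
  · exact mul_mem (mul_mem (pow_mem hb _) ha) (pow_mem hb _)
  · rw [mul_assoc]; exact mul_mem (pow_mem hb _) (hright k)
  · exact mul_mem (hleft j) (pow_mem hb _)
  · exact hboth j k

/-- With `m = s + 2` and `n = t + 2`, all three factorizations are read off from `x = b * (x ^ (s +
1) * b) ^ (t + 1)`. The two-sided one needs two letters `x` on the right, which fails only for `s =
t = 0`, where `x = b * x * b`. -/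
theorem CentralPowers.zpow_mul_mul_zpow_mem {m n : ℕ} {x y z : G}
    (H : CentralPowers m n x y z) (hmn : (m, n) ≠ (2, 2)) {M : Submonoid G} (hx : x ∈ M)
    (hb : y * x * z⁻¹ ∈ M) (j k : ℤ) : (y * x * z⁻¹) ^ j * x * (y * x * z⁻¹) ^ k ∈ M := by
  obtain ⟨s, rfl⟩ := Nat.exists_eq_add_of_le' H.two_le_left
  obtain ⟨t, rfl⟩ := Nat.exists_eq_add_of_le' H.two_le_right
  have hy := H.mem_right hx hb
  have e₁ : y * x * z⁻¹ * x ^ (s + 1) = y := by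
    rw [mul_assoc _ z⁻¹, H.inv_comm, ← mul_assoc, mul_assoc y, ← pow_succ', H.pow_left,
      mul_inv_cancel_right]
  have e₂ : y ^ (t + 1) * (y * x * z⁻¹) = x := by
    rw [mul_assoc y, ← mul_assoc, ← pow_succ, H.pow_right, ← H.inv_comm, mul_inv_cancel_left]
  generalize y * x * z⁻¹ = b at *
  have e₃ : ∀ k, b * (x ^ (s + 1) * b) ^ k = y ^ k * b := by
    intro k
    induction k with
    | zero => simp
    | succ k ih =>
      rw [pow_succ (x ^ (s + 1) * b), ← mul_assoc, ih, mul_assoc, ← mul_assoc b, e₁, ← mul_assoc,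
        ← pow_succ]
  have e₄ : b * (x ^ (s + 1) * b) ^ (t + 1) = x := (e₃ _).trans e₂
  have hw : x ^ (s + 1) * b ∈ M := mul_mem (pow_mem hx _) hb
  have h₁ : y ^ t * b * x ^ s * x * b = x := by
    rw [mul_assoc _ _ x, ← pow_succ, mul_assoc (y ^ t), e₁, ← pow_succ, e₂]
  have h₂ : b * x * (x ^ s * b * (x ^ (s + 1) * b) ^ t) = x := by
    refine Eq.trans ?_ e₄
    rw [pow_succ' _ t, pow_succ' x s]
    simp only [mul_assoc]
  obtain ⟨r, hr, h₃⟩ : ∃ r ∈ M, b * x * r * x * b = x := by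
    rcases t with - | t
    · rcases s with - | s
      · exact absurd rfl hmn
      · refine ⟨x ^ s, pow_mem hx _, ?_⟩
        refine Eq.trans ?_ e₄
        rw [zero_add, pow_one, pow_succ x (s + 1), pow_succ' x s]
        simp only [mul_assoc]
    · refine ⟨x ^ s * b * (x ^ (s + 1) * b) ^ t * x ^ s,
        mul_mem (mul_mem (mul_mem (pow_mem hx _) hb) (pow_mem hw _)) (pow_mem hx _), ?_⟩
      calc b * x * (x ^ s * b * (x ^ (s + 1) * b) ^ t * x ^ s) * x * b
          = b * ((x * x ^ s) * b * (x ^ (s + 1) * b) ^ t * ((x ^ s * x) * b)) := by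
            simp only [mul_assoc]
        _ = x := by rw [← pow_succ', ← pow_succ x s, ← pow_succ', ← pow_succ, e₄]
  exact _root_.zpow_mul_mul_zpow_mem hx hb
    (mul_mem (mul_mem (pow_mem hy _) hb) (pow_mem hx _))
    (mul_mem (mul_mem (pow_mem hx _) hb) (pow_mem hw _)) hr h₁ h₂ h₃ j k

end Absorption

/-! ### Orderings from two generators -/

section Generators

variable {G : Type*} [Group G]

theorem Subsemigroup.mem_closure_of_mem_submonoidClosure {s : Set G} {g : G}
    (hg : g ∈ Submonoid.closure s) (h1 : g ≠ 1) : g ∈ Subsemigroup.closure s := by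
  have : g = 1 ∨ g ∈ Subsemigroup.closure s := by
    induction hg using Submonoid.closure_induction with
    | mem g hg => exact Or.inr (Subsemigroup.subset_closure hg)
    | one => exact Or.inl rfl
    | mul g h _ _ ihg ihh =>
      by_cases hg : g = 1 <;> by_cases hh : h = 1
      · exact Or.inl (by rw [hg, hh, mul_one])
      · right; rw [hg, one_mul]; exact (ihh hh).resolve_left hh
      · right; rw [hh, mul_one]; exact (ihg hg).resolve_left hg
      · exact Or.inr (mul_mem ((ihg hg).resolve_left hg) ((ihh hh).resolve_left hh))
  exact this.resolve_left h1

/-- If the semigroup generated by `a` and `b` is the positive cone of a left ordering, then `a, b`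
defines an isolated left ordering. -/
theorem definesIsolatedOrdering_pair {a b : G} (hgen : Subgroup.closure {a, b} = ⊤)
    (hone : (1 : G) ∉ Subsemigroup.closure {a, b})
    (htotal : ∀ g, g ∈ Submonoid.closure {a, b} ∨ g⁻¹ ∈ Submonoid.closure {a, b}) :
    DefinesIsolatedOrdering ![a, b] := by
  have hrange : Set.range ![a, b] = {a, b} := by simp [Set.pair_comm]
  refine ⟨by rw [IsGenerating, hrange, hgen], ?_⟩
  have hP : wordPositive ![a, b] = (Subsemigroup.closure {a, b} : Set G) := by
    rw [wordPositive, hrange]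
  let o := LeftOrdering.ofCone (wordPositive ![a, b])
    (fun g hg h hh => by rw [hP] at *; exact mul_mem hg hh) (by rw [hP]; exact hone)
    (fun g hg => by
      rw [hP]
      exact (htotal g).imp
        (fun h => Subsemigroup.mem_closure_of_mem_submonoidClosure h hg)
        (fun h => Subsemigroup.mem_closure_of_mem_submonoidClosure h (inv_ne_one.2 hg)))
  have ho : o.positiveCone = wordPositive ![a, b] := LeftOrdering.positiveCone_ofCone ..
  exact ⟨o, ho, o.isIsolated_of_positiveCone_eq _ ho⟩

theorem wordEval_cons {k : ℕ} (S : Fin k → G) (p : Fin k × Bool) (w : List (Fin k × Bool)) :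
    wordEval S (p :: w) = cond p.2 (S p.1) (S p.1)⁻¹ * wordEval S w := by
  simp [wordEval]

theorem wordEval_replicate {k : ℕ} (S : Fin k → G) (i : Fin k) (e : ℕ) :
    wordEval S (List.replicate e (i, true)) = S i ^ e := by
  simp [wordEval]

/-- A word on `a b` and `b⁻¹` without the letter `(a b)⁻¹` represents a power of `b` or, if it
contains `a b`, an element of the semigroup which stays there under multiplication by powers
of `b`. -/
theorem wordEval_mem_closure {a b : G}
    (habs : ∀ j k : ℤ, b ^ j * a * b ^ k ∈ Subsemigroup.closure {a, b})
    (w : List (Fin 2 × Bool)) (hw : ((0 : Fin 2), false) ∉ w) :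
    (((0 : Fin 2), true) ∉ w → ∃ k : ℤ, wordEval ![a * b, b⁻¹] w = b ^ k) ∧
      (((0 : Fin 2), true) ∈ w →
        ∀ j : ℤ, b ^ j * wordEval ![a * b, b⁻¹] w ∈ Subsemigroup.closure {a, b}) := by
  induction w with
  | nil => exact ⟨fun _ => ⟨0, by simp [wordEval]⟩, fun h => by simp at h⟩
  | cons p w ih =>
    obtain ⟨ih₁, ih₂⟩ := ih fun h => hw (List.mem_cons_of_mem _ h)
    rw [wordEval_cons]
    have hpow : ∀ k : ℤ, cond p.2 (![a * b, b⁻¹] p.1) (![a * b, b⁻¹] p.1)⁻¹ = b ^ k →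
        ((0 : Fin 2), true) ≠ p →
        (((0 : Fin 2), true) ∉ p :: w → ∃ k : ℤ,
          cond p.2 (![a * b, b⁻¹] p.1) (![a * b, b⁻¹] p.1)⁻¹ * wordEval ![a * b, b⁻¹] w = b ^ k) ∧
        (((0 : Fin 2), true) ∈ p :: w → ∀ j : ℤ,
          b ^ j * (cond p.2 (![a * b, b⁻¹] p.1) (![a * b, b⁻¹] p.1)⁻¹ *
            wordEval ![a * b, b⁻¹] w) ∈ Subsemigroup.closure {a, b}) := by
      intro k hk hp
      rw [hk]
      refine ⟨fun h => ?_, fun h j => ?_⟩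
      · obtain ⟨l, hl⟩ := ih₁ fun h' => h (List.mem_cons_of_mem _ h')
        exact ⟨k + l, by rw [hl, zpow_add]⟩
      · rw [← mul_assoc, ← zpow_add]
        exact ih₂ ((List.mem_cons.1 h).resolve_left hp) _
    obtain ⟨i, s⟩ := p
    fin_cases i <;> cases s
    · simp at hw
    · refine ⟨fun h => by simp at h, fun _ j => ?_⟩
      -- The trailing `b` is absorbed by the rest of the word if that contains `a * b`, and
      -- otherwise joins its power of `b`.
      change b ^ j * (a * b * wordEval ![a * b, b⁻¹] w) ∈ _
      by_cases h : ((0 : Fin 2), true) ∈ w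
      · have := mul_mem (habs j 0) (ih₂ h 1)
        simpa [mul_assoc] using this
      · obtain ⟨k, hk⟩ := ih₁ h
        have := habs j (1 + k)
        rw [hk]
        simpa [mul_assoc, zpow_add] using this
    · exact hpow 1 (by simp) (by simp)
    · exact hpow (-1) (by simp) (by simp)

/-- If the semigroup generated by `a` and `b` is a positive cone that contains all products
`b ^ j * a * b ^ k`, then `a * b, b⁻¹` defines a Dehornoy-like ordering. -/
theorem definesDehornoyLikeOrdering_pair {a b : G} (hgen : Subgroup.closure {a, b} = ⊤)
    (hone : (1 : G) ∉ Subsemigroup.closure {a, b})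
    (htotal : ∀ g, g ∈ Submonoid.closure {a, b} ∨ g⁻¹ ∈ Submonoid.closure {a, b})
    (habs : ∀ j k : ℤ, b ^ j * a * b ^ k ∈ Subsemigroup.closure {a, b}) :
    DefinesDehornoyLikeOrdering ![a * b, b⁻¹] := by
  have hbpow : ∀ e : ℕ, b ^ (e + 1) ∈ Subsemigroup.closure ({a, b} : Set G) := by
    intro e
    have hb : b ∈ Subsemigroup.closure ({a, b} : Set G) := Subsemigroup.subset_closure (by simp)
    induction e with
    | zero => simpa using hb
    | succ e ih => rw [pow_succ]; exact mul_mem ih hb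
  refine ⟨?_, LeftOrdering.ofCone (sigmaPositive ![a * b, b⁻¹])
    (fun g hg h hh => sigmaPositive_mul_mem _ hg hh) ?_ ?_, LeftOrdering.positiveCone_ofCone ..⟩
  · have hrange : Set.range ![a * b, b⁻¹] = {a * b, b⁻¹} := by simp [Set.pair_comm]
    rw [IsGenerating, hrange, eq_top_iff, ← hgen, Subgroup.closure_le]
    have h₁ : a * b ∈ Subgroup.closure {a * b, b⁻¹} := Subgroup.subset_closure (by simp)
    have h₂ : b⁻¹ ∈ Subgroup.closure {a * b, b⁻¹} := Subgroup.subset_closure (by simp)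
    rintro _ (rfl | rfl)
    · simpa using mul_mem h₁ h₂
    · simpa using inv_mem h₂
  · rintro ⟨i, w, ⟨hw₁, hw₂, hw₃⟩, hw⟩
    obtain rfl | rfl : i = 0 ∨ i = 1 := by lia
    · have := (wordEval_mem_closure habs w hw₂).2 hw₁ 0
      rw [hw] at this
      exact hone (by simpa using this)
    · have hrep : w = List.replicate w.length ((1 : Fin 2), true) := by
        refine List.eq_replicate_of_mem fun p hp => ?_
        obtain ⟨i, s⟩ := p
        have hi : i = 1 := by
          have := hw₃ _ hp
          simp only at this
          lia
        subst hi
        cases s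
        · exact absurd hp hw₂
        · rfl
      obtain ⟨e, he⟩ := Nat.exists_eq_succ_of_ne_zero (List.length_pos_of_mem hw₁).ne'
      rw [hrep, wordEval_replicate, he] at hw
      refine hone ?_
      have h : b ^ (e + 1) = 1 := by simpa using hw
      exact h ▸ hbpow e
  -- Here `a = (a * b) * b⁻¹` is the word `s₁ s₂`, and `b` is the letter `s₂⁻¹`; only the pure
  -- powers of `b` change sign.
  · have key : ∀ g ∈ Subsemigroup.closure ({a, b} : Set G),
        (∃ w, IsPositiveWord 0 w ∧ wordEval ![a * b, b⁻¹] w = g) ∨ ∃ e : ℕ, g = b ^ (e + 1) := by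
      intro g hg
      have hcons : ∀ v w, IsPositiveWord (0 : Fin 2) v → ((0 : Fin 2), false) ∉ w →
          IsPositiveWord (0 : Fin 2) (v ++ w) ∧ IsPositiveWord (0 : Fin 2) (w ++ v) := by
        rintro v w ⟨hv₁, hv₂, -⟩ hw
        exact ⟨⟨by simp [hv₁], by simp [hv₂, hw], fun _ _ => Fin.zero_le _⟩,
          ⟨by simp [hv₁], by simp [hv₂, hw], fun _ _ => Fin.zero_le _⟩⟩
      have hb : ∀ e : ℕ, wordEval ![a * b, b⁻¹] (List.replicate e ((1 : Fin 2), false)) = b ^ e := by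
        simp [wordEval]
      have hb' : ∀ e : ℕ, ((0 : Fin 2), false) ∉ List.replicate e ((1 : Fin 2), false) := by
        simp [List.mem_replicate]
      induction hg using Subsemigroup.closure_induction with
      | mem g hg =>
        rcases hg with rfl | rfl
        · exact Or.inl ⟨[(0, true), (1, true)], ⟨by simp, by simp, fun _ _ => Fin.zero_le _⟩,
            by simp [wordEval]⟩
        · exact Or.inr ⟨0, by simp⟩
      | mul g h _ _ ihg ihh =>
        rcases ihg with ⟨v, hv, rfl⟩ | ⟨e, rfl⟩ <;> rcases ihh with ⟨w, hw, rfl⟩ | ⟨f, rfl⟩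
        · exact Or.inl ⟨v ++ w, (hcons v w hv hw.2.1).1, wordEval_append ..⟩
        · exact Or.inl ⟨_, (hcons v _ hv (hb' (f + 1))).1, by rw [wordEval_append, hb]⟩
        · exact Or.inl ⟨_, (hcons w _ hw (hb' (e + 1))).2, by rw [wordEval_append, hb]⟩
        · exact Or.inr ⟨e + f + 1, by rw [← pow_add]; congr 1; lia⟩
    have key' : ∀ g ∈ Subsemigroup.closure ({a, b} : Set G),
        g ∈ sigmaPositive ![a * b, b⁻¹] ∨ g⁻¹ ∈ sigmaPositive ![a * b, b⁻¹] := by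
      intro g hg
      rcases key g hg with ⟨w, hw, h⟩ | ⟨e, rfl⟩
      · exact Or.inl ⟨0, w, hw, h⟩
      · refine Or.inr ⟨1, List.replicate (e + 1) (1, true), ⟨by simp, ?_, ?_⟩, ?_⟩
        · simp [List.mem_replicate]
        · intro p hp
          rw [List.eq_of_mem_replicate hp]
        · rw [wordEval_replicate]; simp
    intro g hg
    rcases htotal g with h | h
    · exact key' g (Subsemigroup.mem_closure_of_mem_submonoidClosure h hg)
    · have := key' _ (Subsemigroup.mem_closure_of_mem_submonoidClosure h (inv_ne_one.2 hg))
      rw [inv_inv] at this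
      exact this.symm

end Generators

/-! ### The group with x ^ m = y ^ n -/

namespace TorusGroup

theorem x_pow_eq_y_pow (m n : ℕ) : x m n ^ m = y m n ^ n := by
  have h : PresentedGroup.mk
      ({FreeGroup.of 0 ^ m * (FreeGroup.of 1 ^ n)⁻¹} : Set (FreeGroup (Fin 2)))
      (FreeGroup.of 0 ^ m * (FreeGroup.of 1 ^ n)⁻¹) = 1 :=
    PresentedGroup.one_of_mem (Set.mem_singleton _)
  rw [map_mul, map_inv, map_pow, map_pow, mul_inv_eq_one] at h
  exact h

theorem closure_x_y (m n : ℕ) : Subgroup.closure {x m n, y m n} = ⊤ := by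
  rw [← PresentedGroup.closure_range_of]
  congr 1
  ext g
  simp [x, y, Fin.exists_fin_two, eq_comm]

/-- The homomorphism to `H` given by the images of the two generators. -/
def lift {m n : ℕ} {H : Type*} [Group H] (u v : H) (h : u ^ m = v ^ n) : TorusGroup m n →* H :=
  PresentedGroup.toGroup (f := ![u, v]) (by simp [h])

theorem lift_x {m n : ℕ} {H : Type*} [Group H] (u v : H) (h : u ^ m = v ^ n) :
    lift u v h (x m n) = u :=
  PresentedGroup.toGroup.of _

theorem lift_y {m n : ℕ} {H : Type*} [Group H] (u v : H) (h : u ^ m = v ^ n) :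
    lift u v h (y m n) = v :=
  PresentedGroup.toGroup.of _

theorem centralPowers {m n : ℕ} (hm : 2 ≤ m) (hn : 2 ≤ n) :
    CentralPowers m n (x m n) (y m n) (x m n ^ m) where
  two_le_left := hm
  two_le_right := hn
  comm g := by
    have hg : g ∈ Subgroup.closure {x m n, y m n} := closure_x_y m n ▸ Subgroup.mem_top g
    have hle : Subgroup.closure {x m n, y m n} ≤ Subgroup.centralizer {x m n ^ m} := by
      rw [Subgroup.closure_le]
      rintro _ (rfl | rfl)
      · exact Subgroup.mem_centralizer_singleton_iff.2 (Commute.self_pow _ _)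
      · rw [x_pow_eq_y_pow]
        exact Subgroup.mem_centralizer_singleton_iff.2 (Commute.self_pow _ _)
    exact (Subgroup.mem_centralizer_singleton_iff.1 (hle hg)).symm
  pow_left := rfl
  pow_right := (x_pow_eq_y_pow m n).symm

/-- The homomorphism to ℤ with `x ↦ n`, `y ↦ m` sends this element to `m * e * n`. -/
theorem x_pow_pow_ne_one {m n : ℕ} (hm : 0 < m) (hn : 0 < n) (e : ℕ) (he : 0 < e) :
    (x m n ^ m) ^ e ≠ 1 := by
  intro h
  rw [← pow_mul] at h
  let φ : TorusGroup m n →* Multiplicative ℤ :=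
    lift (Multiplicative.ofAdd (n : ℤ)) (Multiplicative.ofAdd (m : ℤ))
      (by rw [← ofAdd_nsmul, ← ofAdd_nsmul, nsmul_eq_mul, nsmul_eq_mul, mul_comm])
  have h₁ := congrArg φ h
  rw [map_one, map_pow, lift_x, ← ofAdd_nsmul, ofAdd_eq_one, nsmul_eq_mul] at h₁
  have : m * e * n = 0 := by exact_mod_cast h₁
  have : 0 < m * e * n := by positivity
  lia

theorem ofAdd_one_pow_ne_one {k i : ℕ} (hi₀ : 0 < i) (hi : i < k) :
    (Multiplicative.ofAdd (1 : ZMod k)) ^ i ≠ 1 := by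
  rw [← ofAdd_nsmul, Ne, ofAdd_eq_one, nsmul_one, ZMod.natCast_eq_zero_iff]
  exact Nat.not_dvd_of_pos_of_lt hi₀ hi

theorem ofAdd_one_pow_self (k : ℕ) : (Multiplicative.ofAdd (1 : ZMod k)) ^ k = 1 := by
  rw [← ofAdd_nsmul, ofAdd_eq_one, nsmul_one, ZMod.natCast_self]

theorem one_notMem_closure {m n : ℕ} (hm : 2 ≤ m) (hn : 2 ≤ n) :
    (1 : TorusGroup m n) ∉
      Subsemigroup.closure {x m n, y m n * x m n * (x m n ^ m)⁻¹} := by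
  let K : Fin 2 → Type := fun i => Multiplicative (ZMod (![m, n] i))
  let u : K 0 := Multiplicative.ofAdd (1 : ZMod m)
  let v : K 1 := Multiplicative.ofAdd (1 : ZMod n)
  have hu : (Monoid.CoprodI.of u : Monoid.CoprodI K) ^ m = 1 := by
    rw [← map_pow, show u ^ m = 1 from ofAdd_one_pow_self m, map_one]
  have hv : (Monoid.CoprodI.of v : Monoid.CoprodI K) ^ n = 1 := by
    rw [← map_pow, show v ^ n = 1 from ofAdd_one_pow_self n, map_one]
  have huv := hu.trans hv.symm
  refine (centralPowers hm hn).one_notMem_closure (K := K) (u := u) (v := v)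
    (fun i => ofAdd_one_pow_ne_one) (fun j => ofAdd_one_pow_ne_one) (lift _ _ huv)
    (lift_x _ _ huv) (lift_y _ _ huv) ?_ (x_pow_pow_ne_one (by lia) (by lia))
  rw [map_pow, lift_x, hu]

theorem closure_pair {m n : ℕ} (hm : 2 ≤ m) (hn : 2 ≤ n) :
    Subgroup.closure {x m n, y m n * x m n * (x m n ^ m)⁻¹} = ⊤ := by
  rw [eq_top_iff, ← closure_x_y, Subgroup.closure_le]
  have hx : x m n ∈ Subgroup.closure {x m n, y m n * x m n * (x m n ^ m)⁻¹} :=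
    Subgroup.subset_closure (by simp)
  rintro _ (rfl | rfl)
  · exact hx
  · exact (centralPowers hm hn).mem_right
      (M := (Subgroup.closure {x m n, y m n * x m n * (x m n ^ m)⁻¹}).toSubmonoid) hx
      (Subgroup.subset_closure (by simp))

theorem genA_eq (m n : ℕ) : genA m n = ![x m n, y m n * x m n * (x m n ^ m)⁻¹] := by
  rw [genA, add_comm, zpow_add, zpow_one, zpow_neg, zpow_natCast, mul_assoc]

theorem genS_eq (m n : ℕ) : genS m n =
    ![x m n * (y m n * x m n * (x m n ^ m)⁻¹), (y m n * x m n * (x m n ^ m)⁻¹)⁻¹] := by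
  have h : x m n ^ ((m : ℤ) - 1) * (y m n)⁻¹ = (y m n * x m n * (x m n ^ m)⁻¹)⁻¹ := by
    rw [zpow_sub, zpow_one, zpow_natCast]
    simp [mul_assoc]
  rw [genS, h, add_comm, zpow_add, zpow_one, zpow_neg, zpow_natCast]
  simp only [mul_assoc]

end TorusGroup

theorem theorem3p1 (m n : ℕ) (hm : 2 ≤ m) (hn : 2 ≤ n) (hmn : (m, n) ≠ (2, 2)) :
    DefinesDehornoyLikeOrdering (TorusGroup.genS m n) ∧
      DefinesIsolatedOrdering (TorusGroup.genA m n) := by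
  have H := TorusGroup.centralPowers hm hn
  have hone := TorusGroup.one_notMem_closure hm hn
  have hgen := TorusGroup.closure_pair hm hn
  rw [TorusGroup.genS_eq, TorusGroup.genA_eq]
  set a := TorusGroup.x m n
  set b := TorusGroup.y m n * a * (a ^ m)⁻¹ with hb_def
  have ha : a ∈ Submonoid.closure {a, b} := Submonoid.subset_closure (by simp)
  have hb : b ∈ Submonoid.closure {a, b} := Submonoid.subset_closure (by simp)
  have htotal := H.mem_or_inv_mem (TorusGroup.closure_x_y m n) ha hb
  have hb_pos : b ∈ Subsemigroup.closure {a, b} := Subsemigroup.subset_closure (by simp)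
  have hb_ne : b ≠ 1 := fun h => hone (h ▸ hb_pos)
  have hb_inv : b⁻¹ ∉ Submonoid.closure {a, b} := fun h => hone <| by
    simpa using mul_mem hb_pos
      (Subsemigroup.mem_closure_of_mem_submonoidClosure h (inv_ne_one.2 hb_ne))
  have habs : ∀ j k : ℤ, b ^ j * a * b ^ k ∈ Subsemigroup.closure {a, b} := by
    intro j k
    refine Subsemigroup.mem_closure_of_mem_submonoidClosure
      (H.zpow_mul_mul_zpow_mem hmn ha hb j k) fun h => ?_
    -- If the product were 1, `a` would be a power of `b`, and this exponent makes the absorbed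
    -- element equal to `b⁻¹`.
    have h' := H.zpow_mul_mul_zpow_mem hmn ha hb (-1 + k + j) 0
    rw [← hb_def, zpow_zero, mul_one, add_assoc, zpow_add, zpow_add, mul_assoc, mul_assoc,
      eq_inv_of_mul_eq_one_left h, mul_inv_cancel, mul_one, zpow_neg_one] at h'
    exact hb_inv h'
  exact ⟨definesDehornoyLikeOrdering_pair hgen hone htotal habs,
    definesIsolatedOrdering_pair hgen hone htotal⟩
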